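/- **Conventions.** A signature is a sequence $\Sigma=(\Sigma_n)_{n\in\mathbb N}$ of disjoint sets of connectives; $F(\Sigma)$ is the set of $\Sigma$-formulas over the variables $x_0,x_1,\dots$, and $F_n(\Sigma)$ is the set of formulas all of whose variables are among $x_0,\dots,x_{n-1}$. A logic $l=(\Sigma,\vdash)$ is a signature with a finitary, structural Tarskian consequence relation on $F(\Sigma)$. A flexible morphism $h:\Sigma\to\Sigma'$ assigns to each $c\in\Sigma_n$ a $\Sigma'$-formula $h(c)$ whose set of variables is exactly $\{x_0,\dots,x_{n-1}\}$; $\check h:F(\Sigma)\to F(\Sigma')$ is its extension, which fixes variables and satisfies $\check h(c(\psi_0,\dots,\psi_{n-1}))=h(c)[x_i\mid\check h(\psi_i)]_{i<n}$. A translation $h:(\Sigma,\vdash)\to(\Sigma',\vdash')$ is a flexible morphism such that $\Gamma\vdash\varphi$ implies $\check h[\Gamma]\vdash'\check h(\varphi)$. $\Sigma\text{-Str}$ is the category of all $\Sigma$-algebras (the empty one is allowed when $\Sigma_0=\varnothing$) and homomorphisms. For an algebraizable logic $a$ (in the sense of Blok and Pigozzi), with algebraizing pairs $\langle\tau,\Delta\rangle$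 ($\tau$ the defining equations, $\Delta$ the equivalence formulas), $QV(a)$ is the unique quasivariety that is an equivalent algebraic semantics for $a$, viewed as a full subcategory of the algebras over its signature. An $\mathcal A_f$-morphism is a translation $h:a\to a'$ between algebraizable logics such that $\langle\check h(\tau),\check h(\Delta)\rangle$ is an algebraizing pair for $a'$ whenever $\langle\tau,\Delta\rangle$ is one for $a$. A flexible morphism $h:\Sigma\to\Sigma'$ induces the functor $h^\star:\Sigma'\text{-Str}\to\Sigma\text{-Str}$ that keeps underlying sets and functions and interprets $c\in\Sigma_n$ in $h^\star(M')$ by the term operation $h(c)^{M'}$. A translation $h:l\to a'=(\Sigma',\vdash')$ into an algebraizable logic is called $\Delta$-dense if for every $n\in\mathbb N$ and every $\varphi\in F_n(\Sigma')$ there is $\varphi'\in F_n(\Sigma)$ with $\vdash'\check h(\varphi')\,\Delta\,\varphi$ for some system $\Delta$ of equivalence formulas of $a'$. Let $\mathcal K$ be a full subcategory of $\Sigma\text{-Str}$; a functor $H:QV(a')\to\mathcal K$ is hereditary if, whenever $M\in\mathcal K$, $N'\in QV(a')$ and there is an injective $\Sigma$-homomorphism $M\to H(N')$, there is $M'\in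 QV(a')$ with $H(M')=M$. **Proposition.** Let $l$ be a logic over $\Sigma$, and let $a,a'$ be algebraizable logics. (a) Let $h:l\to a'$ be a translation. Then $h$ is $\Delta$-dense if and only if the restricted functor $h^\star\!\restriction\,:QV(a')\to\Sigma\text{-Str}$ is full, faithful, injective on objects and hereditary. (b) Let $h:a\to a'$ be an $\mathcal A_f$-morphism. Then $h^\star$ restricts to a functor $h^\star\!\restriction\,:QV(a')\to QV(a)$, and $h$ is $\Delta$-dense if and only if this functor is full, faithful, injective on objects and hereditary. -/

import Mathlib

open CategoryTheory

universe u

namespace AlgLogic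

/-- A signature: for every `n`, the set of `n`-ary connectives.
(Disjointness of the levels is automatic, a connective being given together with its arity.) -/
abbrev Signature : Type (u + 1) := ℕ → Type u

/-- The first-order language with the given operation symbols and no relation symbols. -/
abbrev Signature.language (S : Signature.{u}) : FirstOrder.Language.{u, 0} :=
  ⟨S, fun _ => Empty⟩

/-- The absolutely free algebra (as a set of terms) on a set `V` of variables. -/
abbrev Signature.Term (S : Signature.{u}) (V : Type) : Type u := S.language.Term V

/-- The formulas, over the variables `x₀, x₁, x₂, …`. -/
abbrev Signature.Formula (S : Signature.{u}) : Type u := S.Term ℕ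

/-! ### Logics -/

/-- A logic over `S`: a finitary, structural (Tarskian) consequence relation on the formulas. -/
structure Logic (S : Signature.{u}) where
  /-- the consequence relation `Γ ⊢ φ` -/
  Entails : Set S.Formula → S.Formula → Prop
  refl : ∀ Γ φ, φ ∈ Γ → Entails Γ φ
  cut : ∀ Γ Θ φ, Entails Γ φ → (∀ ψ ∈ Γ, Entails Θ ψ) → Entails Θ φ
  mono : ∀ Γ Θ φ, Γ ⊆ Θ → Entails Γ φ → Entails Θ φ
  finitary : ∀ Γ φ, Entails Γ φ → ∃ Θ ⊆ Γ, Θ.Finite ∧ Entails Θ φ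
  structural : ∀ Γ φ (σ : ℕ → S.Formula), Entails Γ φ →
    Entails ((fun ψ => ψ.subst σ) '' Γ) (φ.subst σ)

/-! ### Flexible signature morphisms and translations -/

/-- A flexible morphism of signatures: every `n`-ary connective is sent to a formula
in which exactly the variables `x₀, …, xₙ₋₁` occur (`xᵢ` is represented by `i : Fin n`). -/
abbrev FlexMor (S S' : Signature.{u}) : Type u :=
  ∀ n : ℕ, S n → {t : S'.Term (Fin n) // t.varFinset = Finset.univ}

/-- The extension of a flexible morphism to formulas: identity on the variables, and
`c(ψ₀, …, ψₙ₋₁) ↦ h(c)[x₀ | ȟ(ψ₀), …, xₙ₋₁ | ȟ(ψₙ₋₁)]`. -/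
def FlexMor.ext {S S' : Signature.{u}} (h : FlexMor S S') {V : Type} : S.Term V → S'.Term V
  | .var x => .var x
  | .func (l := n) c ts => (h n c).1.subst (fun i => FlexMor.ext h (ts i))

/-- `h` is a translation from `l` to `l'`, i.e. a morphism of logics. -/
def IsTranslation {S S' : Signature.{u}} (l : Logic S) (l' : Logic S') (h : FlexMor S S') :
    Prop :=
  ∀ (Γ : Set S.Formula) (φ : S.Formula),
    l.Entails Γ φ → l'.Entails (h.ext '' Γ) (h.ext φ)

/-! ### The category of all algebras over a signature -/

/-- A (possibly empty) algebra over the signature `S`. -/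
structure Str (S : Signature.{u}) where
  /-- the underlying set -/
  carrier : Type u
  /-- the interpretation of the connectives -/
  op : ∀ n : ℕ, S n → (Fin n → carrier) → carrier

/-- Term evaluation in an algebra is Mathlib's `Term.realize` for this structure. -/
instance {S : Signature.{u}} (M : Str S) : S.language.Structure M.carrier where
  funMap := fun {n} c xs => M.op n c xs
  RelMap := fun r _ => r.elim

/-- Homomorphisms of algebras. -/
@[ext]
structure Str.Hom {S : Signature.{u}} (M N : Str S) where
  /-- the underlying function -/
  toFun : M.carrier → N.carrier
  map_op : ∀ (n : ℕ) (c : S n) (xs : Fin n → M.carrier),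
    toFun (M.op n c xs) = N.op n c (fun i => toFun (xs i))

instance (S : Signature.{u}) : Category (Str S) where
  Hom M N := Str.Hom M N
  id M := ⟨fun x => x, fun _ _ _ => rfl⟩
  comp f g := ⟨fun x => g.toFun (f.toFun x), fun n c xs => by rw [f.map_op, g.map_op]⟩

theorem Str.Hom.map_realize {S : Signature.{u}} {M N : Str S} (f : Str.Hom M N) {V : Type}
    (t : S.Term V) (v : V → M.carrier) :
    f.toFun (t.realize v) = t.realize (fun i => f.toFun (v i)) := by
  induction t with
  | var x => rfl
  | func c ts ih =>
    refine (f.map_op _ c _).trans ?_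
    exact congrArg (N.op _ c) (funext fun i => ih i)

/-- The functor `h⋆` from `S'`-algebras to `S`-algebras: same underlying set and functions, with
an `n`-ary connective `c` interpreted as the operation defined by the term `h(c)`. -/
def FlexMor.star {S S' : Signature.{u}} (h : FlexMor S S') : Str S' ⥤ Str S where
  obj M := ⟨M.carrier, fun n c xs => (h n c).1.realize xs⟩
  map f := ⟨f.toFun, fun n c xs => Str.Hom.map_realize f (h n c).1 xs⟩

/-! ### Equational consequence, quasivarieties -/

/-- An equation `φ ≡ ψ`, as a pair of formulas. -/
abbrev Equation (S : Signature.{u}) : Type u := S.Formula × S.Formula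

/-- The equation holds in `M` under the assignment `v` of the variables (equivalently, under the
homomorphism from the formula algebra to `M` determined by `v`). -/
def Equation.Holds {S : Signature.{u}} (e : Equation S) (M : Str S) (v : ℕ → M.carrier) : Prop :=
  e.1.realize v = e.2.realize v

/-- The equational consequence relation of a class `K` of algebras. -/
def EqConseq {S : Signature.{u}} (K : ObjectProperty (Str S)) (Γ : Set (Equation S))
    (e : Equation S) : Prop :=
  ∀ M : Str S, K M → ∀ v : ℕ → M.carrier, (∀ g ∈ Γ, Equation.Holds g M v) → Equation.Holds e M v

/-- A quasi-identity: finitely many premises (possibly none) and a conclusion. -/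
structure QuasiIdentity (S : Signature.{u}) where
  premises : List (Equation S)
  conclusion : Equation S

/-- Validity of a quasi-identity in an algebra. -/
def QuasiIdentity.Valid {S : Signature.{u}} (q : QuasiIdentity S) (M : Str S) : Prop :=
  ∀ v : ℕ → M.carrier, (∀ g ∈ q.premises, Equation.Holds g M v) → Equation.Holds q.conclusion M v

/-- A quasivariety: a class of algebras axiomatized by a set of quasi-identities. -/
def IsQuasivariety {S : Signature.{u}} (K : ObjectProperty (Str S)) : Prop :=
  ∃ Q : Set (QuasiIdentity S), ∀ M : Str S, K M ↔ ∀ q ∈ Q, q.Valid M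

/-! ### Algebraizable logics -/

/-- A finite or infinite system `τ(p)` of equations in the single variable `p`. -/
abbrev DefEqs (S : Signature.{u}) : Type u := Set (S.Term (Fin 1) × S.Term (Fin 1))

/-- A finite or infinite system `Δ(p, q)` of formulas in the two variables `p, q`. -/
abbrev EquivFormulas (S : Signature.{u}) : Type u := Set (S.Term (Fin 2))

/-- The set of equations `τ(φ)`. -/
def DefEqs.inst {S : Signature.{u}} (τ : DefEqs S) (φ : S.Formula) : Set (Equation S) :=
  (fun e => (e.1.subst (fun _ => φ), e.2.subst (fun _ => φ))) '' τ

/-- The set of formulas `φ Δ ψ`. -/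
def EquivFormulas.inst {S : Signature.{u}} (Δ : EquivFormulas S) (φ ψ : S.Formula) :
    Set S.Formula :=
  (fun d => d.subst ![φ, ψ]) '' Δ

/-- The class `K` is an equivalent algebraic semantics for the logic `l`,
with defining equations `τ` and equivalence formulas `Δ`. -/
structure IsEquivSemanticsWith {S : Signature.{u}} (l : Logic S) (K : ObjectProperty (Str S))
    (τ : DefEqs S) (Δ : EquivFormulas S) : Prop where
  finite_defEqs : τ.Finite
  finite_equivFormulas : Δ.Finite
  /-- `Γ ⊢ φ` iff `{τ(γ) : γ ∈ Γ} ⊨ τ(φ)` -/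
  entails_iff : ∀ (Γ : Set S.Formula) (φ : S.Formula),
    l.Entails Γ φ ↔ ∀ e ∈ τ.inst φ, EqConseq K (⋃ γ ∈ Γ, τ.inst γ) e
  /-- `φ ≡ ψ ⊨ τ(φ Δ ψ)` -/
  to_delta : ∀ φ ψ : S.Formula, ∀ χ ∈ Δ.inst φ ψ, ∀ e ∈ τ.inst χ, EqConseq K {(φ, ψ)} e
  /-- `τ(φ Δ ψ) ⊨ φ ≡ ψ` -/
  of_delta : ∀ φ ψ : S.Formula, EqConseq K (⋃ χ ∈ Δ.inst φ ψ, τ.inst χ) (φ, ψ)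

/-- `K` is an equivalent algebraic semantics for `l`. -/
def IsEquivSemantics {S : Signature.{u}} (l : Logic S) (K : ObjectProperty (Str S)) : Prop :=
  ∃ (τ : DefEqs S) (Δ : EquivFormulas S), IsEquivSemanticsWith l K τ Δ

/-- `⟨τ, Δ⟩` is an algebraizing pair for `l`. -/
def IsAlgebraizingPair {S : Signature.{u}} (l : Logic S) (τ : DefEqs S) (Δ : EquivFormulas S) :
    Prop :=
  ∃ K : ObjectProperty (Str S), IsEquivSemanticsWith l K τ Δ

/-- The logic `l` is algebraizable (in the sense of Blok and Pigozzi). -/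
def Algebraizable {S : Signature.{u}} (l : Logic S) : Prop :=
  ∃ K : ObjectProperty (Str S), IsEquivSemantics l K

/-- `QV(a)`: the quasivariety that is an equivalent algebraic semantics for `a`. An algebraizable
logic has exactly one such quasivariety `K`, and membership in `QV a` is membership in it. -/
def QV {S : Signature.{u}} (a : Logic S) : ObjectProperty (Str S) :=
  fun M => ∃ K : ObjectProperty (Str S), IsQuasivariety K ∧ IsEquivSemantics a K ∧ K M

/-- The translation `h` is a morphism of algebraizable logics from `a` to `a'`:
it sends algebraizing pairs of `a` to algebraizing pairs of `a'`. -/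
def PreservesAlgebraizingPairs {S S' : Signature.{u}} (a : Logic S) (a' : Logic S')
    (h : FlexMor S S') : Prop :=
  ∀ (τ : DefEqs S) (Δ : EquivFormulas S), IsAlgebraizingPair a τ Δ →
    IsAlgebraizingPair a' ((fun e => (h.ext e.1, h.ext e.2)) '' τ) (h.ext '' Δ)

/-- `h` is `Δ`-dense (with respect to the logic `a'` on its target): for every `n`, every formula
`φ` over `S'` in the variables `x₀, …, xₙ₋₁` there is a formula `φ'` over `S` in the variables
`x₀, …, xₙ₋₁` with `⊢ ȟ(φ') Δ φ`, for some system `Δ` of equivalence formulas of `a'`. -/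
def DeltaDense {S S' : Signature.{u}} (a' : Logic S') (h : FlexMor S S') : Prop :=
  ∀ (n : ℕ) (φ : S'.Term (Fin n)), ∃ φ' : S.Term (Fin n),
    ∃ (τ : DefEqs S') (Δ : EquivFormulas S'), IsAlgebraizingPair a' τ Δ ∧
      ∀ χ ∈ Δ.inst ((h.ext φ').relabel Fin.val) (φ.relabel Fin.val), a'.Entails ∅ χ

/-! ### Hereditary functors -/

/-- A functor `F : D ⥤ C`, where `J : C ⥤ Str S` is the inclusion of a class of algebras, is
hereditary: if `M` is an object of `C` with an injective homomorphism to some `F(N')`, then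
`M = F(M')` for some `M'`. -/
def Hereditary {S : Signature.{u}} {C D : Type*} [Category C] [Category D] (J : C ⥤ Str S)
    (F : D ⥤ C) : Prop :=
  ∀ (M : C) (N' : D),
    (∃ j : Str.Hom (J.obj M) (J.obj (F.obj N')), Function.Injective j.toFun) →
      ∃ M' : D, F.obj M' = M

/-- `F` is full, faithful, injective on objects and hereditary. -/
structure IsHereditaryFullEmbedding {S : Signature.{u}} {C D : Type*} [Category C] [Category D]
    (J : C ⥤ Str S) (F : D ⥤ C) : Prop where
  full : F.Full
  faithful : F.Faithful
  injective_obj : Function.Injective F.obj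
  hereditary : Hereditary J F

end AlgLogic

namespace AlgLogic

open FirstOrder.Language (Term)

variable {S S' : Signature.{u}}

/-! ### Terms and their evaluation -/

/-! Since `⊢ φ Δ ψ` in `a'` means that `φ ≡ ψ` holds throughout `QV a'`, density says that every
term operation over `S'` on these algebras is induced by a term over `S`
(`deltaDense_iff_termDense`). Then the operations of `S'` are uniformly `S`-definable:
`S`-homomorphisms preserve them, reducts determine them, and they restrict to `S`-subalgebras, which
stay in the quasivariety. Faithfulness is automatic, as `h.star` keeps functions. Conversely, in the
free algebra of `QV a'` on `n` generators take the `S`-subalgebra generated by the variables.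
Heredity makes it a reduct and fullness makes its inclusion an `S'`-homomorphism, so it contains the
class of every `φ` (`termDense_of_hereditary`). Both parts are cases of `deltaDense_iff`; part (b)
also needs `qv_star_obj`. -/

theorem Signature.Term.subst_subst {V W X : Type} (t : S.Term V) (σ : V → S.Term W)
    (ρ : W → S.Term X) :
    Term.subst (Term.subst t σ) ρ = Term.subst t (fun i => Term.subst (σ i) ρ) := by
  induction t with
  | var x => rfl
  | func c ts ih => simp only [Term.subst, ih]

theorem Signature.Term.subst_var {V : Type} (t : S.Term V) :
    Term.subst t (Term.var (L := S.language)) = t := by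
  induction t with
  | var x => rfl
  | func c ts ih => simp only [Term.subst, ih]

theorem FlexMor.ext_subst (h : FlexMor S S') {V W : Type} (t : S.Term V) (σ : V → S.Term W) :
    h.ext (Term.subst t σ) = Term.subst (h.ext t) (fun i => h.ext (σ i)) := by
  induction t with
  | var x => simp only [Term.subst, FlexMor.ext]
  | func c ts ih =>
    simp only [Term.subst, FlexMor.ext, Signature.Term.subst_subst, ih]

/-- The value of a term in an algebra. -/
abbrev Str.eval (M : Str S) {V : Type} (t : S.Term V) (v : V → M.carrier) : M.carrier :=
  t.realize v

theorem Str.eval_subst (M : Str S) {V W : Type} (t : S.Term V) (σ : V → S.Term W)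
    (v : W → M.carrier) :
    M.eval (Term.subst t σ) v = M.eval t (fun i => M.eval (σ i) v) :=
  FirstOrder.Language.Term.realize_subst

theorem Str.eval_relabel (M : Str S) {V W : Type} (t : S.Term V) (r : V → W)
    (v : W → M.carrier) : M.eval (t.relabel r) v = M.eval t (v ∘ r) :=
  FirstOrder.Language.Term.realize_relabel

theorem FlexMor.eval_ext (h : FlexMor S S') (M : Str S') {V : Type} (t : S.Term V)
    (v : V → M.carrier) : M.eval (h.ext t) v = (h.star.obj M).eval t v := by
  induction t with
  | var x => simp only [FlexMor.ext]; rfl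
  | func c ts ih =>
    simp only [FlexMor.ext]
    refine (M.eval_subst _ _ _).trans ?_
    exact congrArg (M.eval (h _ c).1) (funext ih)

theorem Equation.holds_def (e : Equation S) (M : Str S) (v : ℕ → M.carrier) :
    e.Holds M v ↔ M.eval e.1 v = M.eval e.2 v := Iff.rfl

theorem FlexMor.holds_ext (h : FlexMor S S') (e : Equation S) (M : Str S')
    (v : ℕ → M.carrier) :
    Equation.Holds (h.ext e.1, h.ext e.2) M v ↔ e.Holds (h.star.obj M) v := by
  rw [Equation.holds_def, h.eval_ext, h.eval_ext]
  rfl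

/-! ### Equivalent algebraic semantics -/

/-- The set of formulas `φ Δ ψ`, for the equations `φ ≡ ψ` in `E`. -/
def EquivFormulas.insts (Δ : EquivFormulas S) (E : Set (Equation S)) : Set S.Formula :=
  ⋃ g ∈ E, Δ.inst g.1 g.2

namespace IsEquivSemanticsWith

variable {l : Logic S} {K K₁ K₂ : ObjectProperty (Str S)} {τ τ₁ τ₂ : DefEqs S}
  {Δ Δ₁ Δ₂ : EquivFormulas S}

/-- In `K`, an equation is interderivable with `τ` applied to its `Δ`-formulas, so equational
consequence is encoded in `l` alone. -/
theorem eqConseq_iff (H : IsEquivSemanticsWith l K τ Δ) (E : Set (Equation S))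
    (e : Equation S) :
    EqConseq K E e ↔ ∀ χ ∈ Δ.inst e.1 e.2, l.Entails (Δ.insts E) χ := by
  constructor
  · intro he χ hχ
    rw [H.entails_iff]
    intro e' he' M hM v hv
    refine H.to_delta e.1 e.2 χ hχ e' he' M hM v ?_
    rintro _ rfl
    refine he M hM v fun g hg => H.of_delta g.1 g.2 M hM v fun e'' he'' => hv e'' ?_
    obtain ⟨γ, hγ, h⟩ := Set.mem_iUnion₂.1 he''
    exact Set.mem_iUnion₂.2 ⟨γ, Set.mem_iUnion₂.2 ⟨g, hg, hγ⟩, h⟩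
  · intro he M hM v hv
    refine H.of_delta e.1 e.2 M hM v fun e' he' => ?_
    obtain ⟨χ, hχ, h⟩ := Set.mem_iUnion₂.1 he'
    refine (H.entails_iff _ _).1 (he χ hχ) e' h M hM v fun e'' he'' => ?_
    obtain ⟨γ, hγ, h⟩ := Set.mem_iUnion₂.1 he''
    obtain ⟨g, hg, hγ⟩ := Set.mem_iUnion₂.1 hγ
    refine H.to_delta g.1 g.2 γ hγ e'' h M hM v ?_
    rintro _ rfl
    exact hv _ hg

/-- Finitarity of `l` gives finitely many premises for each formula of `Δ.inst e.1 e.2`; as `Δ` is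
finite, their union is finite. -/
theorem eqConseq_finitary (H : IsEquivSemanticsWith l K τ Δ) {E : Set (Equation S)}
    {e : Equation S} (he : EqConseq K E e) : ∃ E₀ ⊆ E, E₀.Finite ∧ EqConseq K E₀ e := by
  have key : ∀ χ : S.Formula, ∃ E₀ ⊆ E, E₀.Finite ∧
      (χ ∈ Δ.inst e.1 e.2 → l.Entails (Δ.insts E₀) χ) := by
    intro χ
    by_cases hχ : χ ∈ Δ.inst e.1 e.2
    · obtain ⟨Θ, hΘ, hfin, hent⟩ := l.finitary _ _ ((H.eqConseq_iff E e).1 he χ hχ)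
      have hmem : ∀ θ : Θ, ∃ g ∈ E, θ.1 ∈ Δ.inst g.1 g.2 := fun θ => by
        simpa [EquivFormulas.insts] using hΘ θ.2
      choose g hgE hg using hmem
      have := hfin.to_subtype
      refine ⟨Set.range g, Set.range_subset_iff.2 hgE, Set.finite_range g, fun _ => ?_⟩
      exact l.mono _ _ _ (fun θ hθ =>
        Set.mem_iUnion₂.2 ⟨g ⟨θ, hθ⟩, Set.mem_range_self _, hg ⟨θ, hθ⟩⟩) hent
    · exact ⟨∅, Set.empty_subset _, Set.finite_empty, fun h => absurd h hχ⟩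
  choose E₀ hsub hfin hent using key
  refine ⟨⋃ χ ∈ Δ.inst e.1 e.2, E₀ χ, Set.iUnion₂_subset fun χ _ => hsub χ,
    (H.finite_equivFormulas.image _).biUnion fun χ _ => hfin χ, ?_⟩
  rw [H.eqConseq_iff]
  refine fun χ hχ => l.mono _ _ _ ?_ (hent χ hχ)
  exact Set.biUnion_subset_biUnion_left (Set.subset_biUnion_of_mem (u := E₀) hχ)

/-- Where `Δ₁` forces `φ = ψ`, the formulas `d(φ, ψ)` and `d(φ, φ)` take the same value, and `d(φ,
φ)` is a theorem of `l` by the second semantics. -/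
theorem entails_delta (H₁ : IsEquivSemanticsWith l K₁ τ₁ Δ₁)
    (H₂ : IsEquivSemanticsWith l K₂ τ₂ Δ₂) (φ ψ : S.Formula) :
    ∀ χ ∈ Δ₂.inst φ ψ, l.Entails (Δ₁.inst φ ψ) χ := by
  rintro _ ⟨d, hd, rfl⟩
  rw [H₁.entails_iff]
  rintro _ ⟨e, he, rfl⟩ M hM v hv
  have heq : M.eval φ v = M.eval ψ v := H₁.of_delta φ ψ M hM v hv
  have hd' : l.Entails ∅ (d.subst ![φ, φ]) := by
    rw [H₂.entails_iff]
    intro e' he' N hN w _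
    refine H₂.to_delta φ φ _ ⟨d, hd, rfl⟩ e' he' N hN w ?_
    rintro _ rfl
    rfl
  have h₁ := (H₁.entails_iff _ _).1 hd' _ ⟨e, he, rfl⟩ M hM v (by simp)
  have hval : M.eval (d.subst ![φ, φ]) v = M.eval (d.subst ![φ, ψ]) v := by
    rw [Str.eval_subst, Str.eval_subst]
    congr 1
    funext i
    fin_cases i
    · rfl
    · exact heq
  have h₁ : M.eval (e.1.subst _) v = M.eval (e.2.subst _) v := h₁
  change M.eval (e.1.subst _) v = M.eval (e.2.subst _) v
  simp only [Str.eval_subst M e.1, Str.eval_subst M e.2] at h₁ ⊢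
  rwa [hval] at h₁

theorem eqConseq_of_eqConseq (H₁ : IsEquivSemanticsWith l K₁ τ₁ Δ₁)
    (H₂ : IsEquivSemanticsWith l K₂ τ₂ Δ₂) {E : Set (Equation S)} {e : Equation S}
    (he : EqConseq K₁ E e) : EqConseq K₂ E e := by
  rw [H₂.eqConseq_iff]
  intro χ hχ
  refine l.cut _ _ _ (H₁.entails_delta H₂ _ _ χ hχ) fun ψ hψ => ?_
  refine l.cut _ _ _ ((H₁.eqConseq_iff E e).1 he ψ hψ) fun θ hθ => ?_
  obtain ⟨g, hg, hθ⟩ := Set.mem_iUnion₂.1 hθ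
  exact l.mono _ _ _ (fun x hx => Set.mem_iUnion₂.2 ⟨g, hg, hx⟩)
    (H₂.entails_delta H₁ _ _ θ hθ)

theorem congr_eqConseq (H : IsEquivSemanticsWith l K₁ τ Δ)
    (hK : ∀ E e, EqConseq K₁ E e ↔ EqConseq K₂ E e) : IsEquivSemanticsWith l K₂ τ Δ where
  finite_defEqs := H.finite_defEqs
  finite_equivFormulas := H.finite_equivFormulas
  entails_iff Γ φ := by simp only [← hK]; exact H.entails_iff Γ φ
  to_delta φ ψ χ hχ e he := (hK _ _).1 (H.to_delta φ ψ χ hχ e he)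
  of_delta φ ψ := (hK _ _).1 (H.of_delta φ ψ)

end IsEquivSemanticsWith

/-- The quasivariety generated by `K`, as the class of models of the quasi-identities of `K`. -/
def quasivarietyGenerated (K : ObjectProperty (Str S)) : ObjectProperty (Str S) :=
  fun M => ∀ q : QuasiIdentity S, EqConseq K {g | g ∈ q.premises} q.conclusion → q.Valid M

theorem isQuasivariety_quasivarietyGenerated (K : ObjectProperty (Str S)) :
    IsQuasivariety (quasivarietyGenerated K) :=
  ⟨{q | EqConseq K {g | g ∈ q.premises} q.conclusion}, fun _ => Iff.rfl⟩

namespace IsEquivSemanticsWith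

variable {l : Logic S} {K : ObjectProperty (Str S)} {τ : DefEqs S} {Δ : EquivFormulas S}

theorem eqConseq_quasivarietyGenerated (H : IsEquivSemanticsWith l K τ Δ)
    (E : Set (Equation S)) (e : Equation S) :
    EqConseq K E e ↔ EqConseq (quasivarietyGenerated K) E e := by
  constructor
  · intro he M hM v hv
    -- Quasi-identities have finitely many premises, so `E` must first be cut down.
    obtain ⟨E₀, hsub, hfin, he₀⟩ := H.eqConseq_finitary he
    refine hM ⟨hfin.toFinset.toList, e⟩ (by simpa using he₀) v fun g hg => hv g (hsub ?_)
    simpa using hg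
  · intro he M hM
    exact he M fun q hq => hq M hM

theorem isEquivSemanticsWith_quasivarietyGenerated (H : IsEquivSemanticsWith l K τ Δ) :
    IsEquivSemanticsWith l (quasivarietyGenerated K) τ Δ :=
  H.congr_eqConseq H.eqConseq_quasivarietyGenerated

theorem qv_eq (H : IsEquivSemanticsWith l K τ Δ) : QV l = quasivarietyGenerated K := by
  ext M
  constructor
  · rintro ⟨K', -, ⟨τ', Δ', H'⟩, hM⟩ q hq
    exact H.eqConseq_of_eqConseq H' hq M hM
  · exact fun hM => ⟨_, isQuasivariety_quasivarietyGenerated K,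
      ⟨τ, Δ, H.isEquivSemanticsWith_quasivarietyGenerated⟩, hM⟩

end IsEquivSemanticsWith

theorem IsAlgebraizingPair.isEquivSemanticsWith_qv {l : Logic S} {τ : DefEqs S}
    {Δ : EquivFormulas S} (H : IsAlgebraizingPair l τ Δ) :
    IsEquivSemanticsWith l (QV l) τ Δ := by
  obtain ⟨K, H⟩ := H
  rw [H.qv_eq]
  exact H.isEquivSemanticsWith_quasivarietyGenerated

theorem Algebraizable.exists_pair {l : Logic S} (H : Algebraizable l) :
    ∃ τ Δ, IsAlgebraizingPair l τ Δ := by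
  obtain ⟨K, τ, Δ, H⟩ := H
  exact ⟨τ, Δ, K, H⟩

theorem Algebraizable.isQuasivariety_qv {l : Logic S} (H : Algebraizable l) :
    IsQuasivariety (QV l) := by
  obtain ⟨K, τ, Δ, H⟩ := H
  rw [H.qv_eq]
  exact isQuasivariety_quasivarietyGenerated K

theorem IsAlgebraizingPair.entails_delta_iff {l : Logic S} {τ : DefEqs S}
    {Δ : EquivFormulas S} (H : IsAlgebraizingPair l τ Δ) (φ ψ : S.Formula) :
    (∀ χ ∈ Δ.inst φ ψ, l.Entails ∅ χ) ↔ EqConseq (QV l) ∅ (φ, ψ) := by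
  rw [H.isEquivSemanticsWith_qv.eqConseq_iff]
  simp [EquivFormulas.insts]

/-! ### Subalgebras and free algebras -/

theorem IsQuasivariety.of_injective {K : ObjectProperty (Str S)} (hK : IsQuasivariety K)
    {M N : Str S} (j : Str.Hom M N) (hj : Function.Injective j.toFun) (hN : K N) : K M := by
  obtain ⟨Q, hQ⟩ := hK
  refine (hQ M).2 fun q hq v hv => hj ?_
  refine (j.map_realize _ v).trans (Eq.trans ?_ (j.map_realize _ v).symm)
  refine (hQ N).1 hN q hq (fun i => j.toFun (v i)) fun g hg => ?_
  exact (j.map_realize _ v).symm.trans ((congrArg j.toFun (hv g hg)).trans (j.map_realize _ v))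

/-- The congruence of `K`-equality on the algebra of terms. -/
def termSetoid (K : ObjectProperty (Str S)) (V : Type) : Setoid (S.Term V) where
  r s t := ∀ M : Str S, K M → ∀ v : V → M.carrier, M.eval s v = M.eval t v
  iseqv := ⟨fun _ _ _ _ => rfl, fun h M hM v => (h M hM v).symm,
    fun h h' M hM v => (h M hM v).trans (h' M hM v)⟩

/-- The `K`-free algebra on the set `V`. -/
noncomputable def freeStr (K : ObjectProperty (Str S)) (V : Type) : Str S where
  carrier := Quotient (termSetoid K V)
  op n c xs := Quotient.mk _ (.func (L := S.language) (l := n) c fun i => (xs i).out)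

/-- The operations use chosen representatives; `K`-equality being a congruence, the choice does not
matter. -/
theorem freeStr_op_mk (K : ObjectProperty (Str S)) {V : Type} {n : ℕ} (c : S n)
    (ts : Fin n → S.Term V) :
    (freeStr K V).op n c (fun i => Quotient.mk _ (ts i)) =
      Quotient.mk (termSetoid K V) (.func (L := S.language) (l := n) c ts) := by
  refine Quotient.sound fun M hM v => congrArg (M.op n c) (funext fun i => ?_)
  exact Quotient.exact (Quotient.out_eq (Quotient.mk (termSetoid K V) (ts i))) M hM v

theorem freeStr_eval_mk (K : ObjectProperty (Str S)) {V W : Type} (t : S.Term W)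
    (σ : W → S.Term V) :
    (freeStr K V).eval t (fun i => Quotient.mk _ (σ i)) =
      Quotient.mk (termSetoid K V) (Term.subst t σ) := by
  induction t with
  | var x => rfl
  | func c ts ih =>
    refine Eq.trans ?_ (freeStr_op_mk K c _)
    exact congrArg ((freeStr K V).op _ c) (funext ih)

/-- An assignment lifts to a substitution, and equality of classes is validity in all of `K`; so
each quasi-identity is checked in the members of `K`. -/
theorem IsQuasivariety.freeStr_mem {K : ObjectProperty (Str S)} (hK : IsQuasivariety K)
    (V : Type) : K (freeStr K V) := by
  obtain ⟨Q, hQ⟩ := id hK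
  refine (hQ _).2 fun q hq v hv => ?_
  obtain ⟨σ, rfl⟩ : ∃ σ : ℕ → S.Term V, v = fun i => Quotient.mk _ (σ i) :=
    ⟨fun i => (v i).out, funext fun i => (Quotient.out_eq _).symm⟩
  refine (freeStr_eval_mk K _ σ).trans (Eq.trans ?_ (freeStr_eval_mk K _ σ).symm)
  refine Quotient.sound fun M hM w => ?_
  rw [Str.eval_subst, Str.eval_subst]
  refine (hQ M).1 hM q hq _ fun g hg => ?_
  have := Quotient.exact ((freeStr_eval_mk K _ σ).symm.trans
    ((hv g hg).trans (freeStr_eval_mk K _ σ))) M hM w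
  rwa [Str.eval_subst, Str.eval_subst] at this

/-! ### Density, semantically -/

/-- Every term operation on the algebras in `K` is induced by a term over `S`. -/
def TermDense (K : ObjectProperty (Str S')) (h : FlexMor S S') : Prop :=
  ∀ (n : ℕ) (φ : S'.Term (Fin n)), ∃ φ' : S.Term (Fin n),
    ∀ M : Str S', K M → ∀ v : Fin n → M.carrier, (h.star.obj M).eval φ' v = M.eval φ v

theorem deltaDense_iff_termDense {a' : Logic S'} (ha' : Algebraizable a') (h : FlexMor S S') :
    DeltaDense a' h ↔ TermDense (QV a') h := by
  refine forall₂_congr fun n φ => exists_congr fun φ' => ?_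
  constructor
  · rintro ⟨τ, Δ, H, hΔ⟩ M hM v
    rw [H.entails_delta_iff] at hΔ
    -- Variables from `n` on need some value, and `M` is not assumed nonempty; the value of `φ`
    -- itself serves.
    let x : M.carrier := M.eval φ v
    have := hΔ M hM (fun i => if hi : i < n then v ⟨i, hi⟩ else x) (by simp)
    rw [Equation.holds_def, Str.eval_relabel, Str.eval_relabel] at this
    have hv : (fun i => if hi : i < n then v ⟨i, hi⟩ else x) ∘ Fin.val = v := by
      funext i; simp
    rwa [hv, h.eval_ext] at this
  · intro hφ
    obtain ⟨τ, Δ, H⟩ := ha'.exists_pair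
    refine ⟨τ, Δ, H, (H.entails_delta_iff _ _).2 fun M hM v _ => ?_⟩
    rw [Equation.holds_def, Str.eval_relabel, Str.eval_relabel, h.eval_ext]
    exact hφ M hM _

section TermDense

variable {K : ObjectProperty (Str S')} {h : FlexMor S S'}

theorem TermDense.exists_term (H : TermDense K h) {n : ℕ} (c : S' n) :
    ∃ φ : S.Term (Fin n), ∀ M : Str S', K M → ∀ v : Fin n → M.carrier,
      (h.star.obj M).eval φ v = M.op n c v :=
  H n (.func (L := S'.language) (l := n) c fun i => .var i)

theorem TermDense.map_op (H : TermDense K h) {M N : Str S'} (hM : K M) (hN : K N)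
    (f : Str.Hom (h.star.obj M) (h.star.obj N)) (n : ℕ) (c : S' n)
    (xs : Fin n → M.carrier) :
    f.toFun (M.op n c xs) = N.op n c (fun i => f.toFun (xs i)) := by
  obtain ⟨φ, hφ⟩ := H.exists_term c
  exact (congrArg f.toFun (hφ M hM xs)).symm.trans ((f.map_realize φ xs).trans (hφ N hN _))

theorem TermDense.eq_of_star_eq (H : TermDense K h) {M N : Str S'} (hM : K M) (hN : K N)
    (hMN : h.star.obj M = h.star.obj N) : M = N := by
  obtain ⟨A, op⟩ := M
  obtain ⟨B, op'⟩ := N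
  obtain rfl : A = B := congrArg Str.carrier hMN
  congr 1
  funext n c xs
  obtain ⟨φ, hφ⟩ := H.exists_term c
  refine (hφ _ hM xs).symm.trans (Eq.trans ?_ (hφ _ hN xs))
  have hop : (h.star.obj ⟨A, op⟩).op = (h.star.obj ⟨A, op'⟩).op := by
    injection hMN
  have : ∀ o o' : ∀ n : ℕ, S n → (Fin n → A) → A, o = o' →
      (Str.mk A o).eval φ xs = (Str.mk A o').eval φ xs := by
    rintro o _ rfl; rfl
  exact this _ _ hop

/-- Each `c` is interpreted in `M` by the `S`-term inducing it. Then `j` is an `S'`-homomorphism,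
and injectivity pulls back both membership in `K` and the equality of operations. -/
theorem TermDense.exists_star_eq (H : TermDense K h) (hK : IsQuasivariety K) {M : Str S}
    {N : Str S'} (hN : K N) (j : Str.Hom M (h.star.obj N)) (hj : Function.Injective j.toFun) :
    ∃ M' : Str S', K M' ∧ h.star.obj M' = M := by
  choose φ hφ using fun (n : ℕ) (c : S' n) => H.exists_term c
  let M' : Str S' := ⟨M.carrier, fun n c xs => M.eval (φ n c) xs⟩
  let j' : Str.Hom M' N := ⟨j.toFun, fun n c xs =>
    (j.map_realize (φ n c) xs).trans (hφ n c N hN _)⟩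
  refine ⟨M', hK.of_injective j' hj hN, ?_⟩
  have : (h.star.obj M').op = M.op := by
    funext n c xs
    exact hj ((j'.map_realize (h n c).1 xs).trans (j.map_op n c xs).symm)
  exact congrArg (Str.mk M.carrier) this

end TermDense

/-- The subalgebra of term values over `S` of the generators in the free algebra over `S'`. -/
noncomputable def freeSub (K : ObjectProperty (Str S')) (h : FlexMor S S') (V : Type) : Str S where
  carrier := {x : (freeStr K V).carrier //
    ∃ t : S.Term V, (Quotient.mk _ (h.ext t) : (freeStr K V).carrier) = x}
  op n c xs := ⟨(h.star.obj (freeStr K V)).op n c (fun i => (xs i).1), by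
    choose t ht using fun i => (xs i).2
    refine ⟨.func (L := S.language) (l := n) c t, ?_⟩
    simp only [FlexMor.ext, ← ht]
    exact (freeStr_eval_mk K _ _).symm⟩

/-- The inclusion of `freeSub`. -/
noncomputable def freeSubIncl (K : ObjectProperty (Str S')) (h : FlexMor S S') (V : Type) :
    Str.Hom (freeSub K h V) (h.star.obj (freeStr K V)) :=
  ⟨Subtype.val, fun _ _ _ => rfl⟩

theorem freeSubIncl_injective (K : ObjectProperty (Str S')) (h : FlexMor S S') (V : Type) :
    Function.Injective (freeSubIncl K h V).toFun :=
  Subtype.val_injective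

theorem termDense_of_hereditary {K : ObjectProperty (Str S')} {h : FlexMor S S'}
    (hfull : ∀ M N : Str S', K M → K N → ∀ f : Str.Hom (h.star.obj M) (h.star.obj N),
      ∃ g : Str.Hom M N, g.toFun = f.toFun)
    (hK : IsQuasivariety K)
    (hher : ∀ V : Type, ∃ M' : Str S', K M' ∧ h.star.obj M' = freeSub K h V) :
    TermDense K h := by
  intro n φ
  obtain ⟨M', hM', hM'eq⟩ := hher (Fin n)
  have hF := hK.freeStr_mem (Fin n)
  -- With `A` and `j` arbitrary, the equality of objects can be eliminated by `rfl` before fullness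
  -- is applied to `j`.
  have key : ∀ (A : Str S) (j : Str.Hom A (h.star.obj (freeStr K (Fin n)))),
      (∀ i : Fin n, ∃ x, j.toFun x = Quotient.mk (termSetoid K (Fin n)) (.var i)) →
      h.star.obj M' = A → ∃ x, j.toFun x = Quotient.mk (termSetoid K (Fin n)) φ := by
    rintro A j hgen rfl
    obtain ⟨g, hg⟩ := hfull M' _ hM' hF j
    choose x hx using hgen
    refine ⟨M'.eval φ x, ?_⟩
    rw [← hg] at hx ⊢
    refine (g.map_realize φ x).trans ?_
    simp only [hx]
    refine (freeStr_eval_mk K φ _).trans (congrArg _ ?_)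
    exact Signature.Term.subst_var φ
  obtain ⟨⟨x, t, ht⟩, hx⟩ := key (freeSub K h (Fin n)) (freeSubIncl K h (Fin n))
    (fun i => ⟨⟨_, .var i, rfl⟩, by
      simp only [freeSubIncl, FlexMor.ext]; rfl⟩) hM'eq
  refine ⟨t, fun M hM v => ?_⟩
  rw [← h.eval_ext]
  exact Quotient.exact (ht.trans hx) M hM v

/-- Density characterized for the restriction of `h⋆` to any category `C` of algebras that
contains the subalgebras of the images. -/
theorem deltaDense_iff {a' : Logic S'} (ha' : Algebraizable a') (h : FlexMor S S')
    {C : Type*} [Category C] (J : C ⥤ Str S) [J.Full] [J.Faithful]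
    (hJ : Function.Injective J.obj) (F : (QV a').FullSubcategory ⥤ C)
    (hF : F ⋙ J = (QV a').ι ⋙ h.star)
    (hsub : ∀ (M : Str S) (N : (QV a').FullSubcategory)
      (j : Str.Hom M (h.star.obj N.obj)), Function.Injective j.toFun → ∃ X : C, J.obj X = M) :
    DeltaDense a' h ↔ IsHereditaryFullEmbedding J F := by
  have hK := ha'.isQuasivariety_qv
  have hobj : ∀ N : (QV a').FullSubcategory, J.obj (F.obj N) = h.star.obj N.obj :=
    fun N => Functor.congr_obj hF N
  rw [deltaDense_iff_termDense ha']
  constructor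
  · intro H
    -- As `J` is fully faithful, fullness and faithfulness of `F` can be tested on the restriction
    -- of `h.star`.
    have hfull : (F ⋙ J).Full := by
      rw [hF]
      exact ⟨fun {M N} f => ⟨⟨⟨f.toFun, H.map_op M.property N.property f⟩⟩, rfl⟩⟩
    have hfaith : (F ⋙ J).Faithful := by
      rw [hF]
      refine ⟨fun {M N} f g hfg => ?_⟩
      have : f.hom.toFun = g.hom.toFun :=
        congrArg (fun k : Str.Hom (h.star.obj M.obj) (h.star.obj N.obj) => k.toFun) hfg
      exact InducedCategory.hom_ext (Str.Hom.ext this)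
    refine ⟨Functor.Full.of_comp_faithful F J, Functor.Faithful.of_comp F J, ?_, ?_⟩
    · intro M N hMN
      have := congrArg J.obj hMN
      rw [hobj, hobj] at this
      exact ObjectProperty.FullSubcategory.ext (H.eq_of_star_eq M.property N.property this)
    · intro X N hj
      have aux : ∀ A : Str S, A = h.star.obj N.obj →
          (∃ j : Str.Hom (J.obj X) A, Function.Injective j.toFun) →
          ∃ M' : Str S', QV a' M' ∧ h.star.obj M' = J.obj X := by
        rintro _ rfl ⟨j, hj⟩
        exact H.exists_star_eq hK N.property j hj
      obtain ⟨M', hM', he⟩ := aux _ (hobj N) hj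
      exact ⟨⟨M', hM'⟩, hJ ((hobj _).trans he)⟩
  · intro H
    have hfull : ((QV a').ι ⋙ h.star).Full := by
      rw [← hF]
      have := H.full
      infer_instance
    refine termDense_of_hereditary (fun M N hM hN f => ?_) hK fun V => ?_
    · obtain ⟨g, hg⟩ := hfull.map_surjective (X := ⟨M, hM⟩) (Y := ⟨N, hN⟩) f
      exact ⟨g.hom, congrArg Str.Hom.toFun hg⟩
    · let N : (QV a').FullSubcategory := ⟨_, hK.freeStr_mem V⟩
      obtain ⟨X, hX⟩ := hsub _ N (freeSubIncl (QV a') h V) (freeSubIncl_injective _ h V)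
      obtain ⟨M', hM'⟩ := H.hereditary X N (by
        rw [hobj, hX]
        exact ⟨_, freeSubIncl_injective (QV a') h V⟩)
      exact ⟨M'.obj, M'.property, by rw [← hobj, hM', hX]⟩

/-! ### Reducts of algebras in `QV a'` lie in `QV a` -/

theorem EquivFormulas.inst_image_ext (h : FlexMor S S') (Δ : EquivFormulas S)
    (φ ψ : S.Formula) :
    EquivFormulas.inst (h.ext '' Δ) (h.ext φ) (h.ext ψ) = h.ext '' Δ.inst φ ψ := by
  simp only [EquivFormulas.inst, Set.image_image, FlexMor.ext_subst]
  refine Set.image_congr fun d _ => congrArg _ (funext fun i => ?_)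
  fin_cases i <;> rfl

/-- A quasi-identity of `QV a` is encoded by `Δ` as entailments of `a`; `h` transports them to `a'`,
where they decode to the translated quasi-identity because `h.ext '' Δ` belongs to an algebraizing
pair. -/
theorem qv_star_obj {a : Logic S} {a' : Logic S'} {h : FlexMor S S'} (ha : Algebraizable a)
    (ht : IsTranslation a a' h) (hp : PreservesAlgebraizingPairs a a' h) {M : Str S'}
    (hM : QV a' M) : QV a (h.star.obj M) := by
  obtain ⟨τ, Δ, H⟩ := ha.exists_pair
  obtain ⟨K, HK⟩ := id H
  have H' := (hp τ Δ H).isEquivSemanticsWith_qv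
  rw [HK.qv_eq]
  intro q hq v hv
  have key : EqConseq (QV a') ((fun e : Equation S => (h.ext e.1, h.ext e.2)) ''
      {g | g ∈ q.premises}) (h.ext q.conclusion.1, h.ext q.conclusion.2) := by
    rw [H'.eqConseq_iff]
    simp only [EquivFormulas.inst_image_ext, EquivFormulas.insts, Set.biUnion_image]
    rintro _ ⟨χ, hχ, rfl⟩
    refine a'.mono _ _ _ ?_ (ht _ _ ((HK.eqConseq_iff _ _).1 hq χ hχ))
    simp only [EquivFormulas.insts, Set.image_iUnion₂]
    exact subset_rfl
  refine (h.holds_ext _ M v).1 (key M hM v ?_)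
  rintro _ ⟨g, hg, rfl⟩
  exact (h.holds_ext g M v).2 (hv g hg)

end AlgLogic

theorem proposition3 :
    (∀ (S S' : AlgLogic.Signature.{u}) (l : AlgLogic.Logic S) (a' : AlgLogic.Logic S')
        (h : AlgLogic.FlexMor S S'),
      AlgLogic.Algebraizable a' → AlgLogic.IsTranslation l a' h →
      (AlgLogic.DeltaDense a' h ↔
        AlgLogic.IsHereditaryFullEmbedding (𝟭 (AlgLogic.Str S))
          ((AlgLogic.QV a').ι ⋙ h.star))) ∧
    (∀ (S S' : AlgLogic.Signature.{u}) (a : AlgLogic.Logic S) (a' : AlgLogic.Logic S')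
        (h : AlgLogic.FlexMor S S'),
      AlgLogic.Algebraizable a → AlgLogic.Algebraizable a' → AlgLogic.IsTranslation a a' h →
      AlgLogic.PreservesAlgebraizingPairs a a' h →
      ∃ hres : ∀ M' : (AlgLogic.QV a').FullSubcategory,
          AlgLogic.QV a (((AlgLogic.QV a').ι ⋙ h.star).obj M'),
        (AlgLogic.DeltaDense a' h ↔
          AlgLogic.IsHereditaryFullEmbedding (AlgLogic.QV a).ι
            ((AlgLogic.QV a).lift ((AlgLogic.QV a').ι ⋙ h.star) hres))) := by
  refine ⟨fun S S' l a' h ha' _ => ?_, fun S S' a a' h ha ha' ht hp =>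
    ⟨fun M' => AlgLogic.qv_star_obj ha ht hp M'.property, ?_⟩⟩
  · exact AlgLogic.deltaDense_iff ha' h _ (fun _ _ h => h) _ rfl fun M _ _ _ => ⟨M, rfl⟩
  · refine AlgLogic.deltaDense_iff ha' h _
      (fun _ _ h => CategoryTheory.ObjectProperty.FullSubcategory.ext h) _ rfl fun M N j hj => ?_
    -- Subalgebras of reducts remain in the quasivariety `QV a`.
    exact ⟨⟨M, ha.isQuasivariety_qv.of_injective j hj
      (AlgLogic.qv_star_obj ha ht hp N.property)⟩, rfl⟩
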